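/- **Setting.** There are $n\ge 1$ clients, $V\ge 1$ shares to be lent in each of $T$ rounds, and a maximal usage $U\ge 1$. In round $t$ client $i$ draws, independently of everything else, a usage $u_{it}\in\{0,\dots,U\}$ from a distribution $U_i$, and sends a request $r_{it}\in\{0,\dots,U\}$, drawn from a distribution that depends on $u_{it}$ and on her own history $H_t^i$ (her strategy); the *truthful* strategy is $r_{it}=u_{it}$. A mechanism maps the requests $r_t$ and the history $H_t$ (all earlier requests, allocations and executed shares $\min(s_{it},u_{it})$) to a random allocation $S_t=(s_{it})_i$ of nonnegative integers. For distributions $q=(q_1,\dots,q_n)$ on $\{0,\dots,U\}$ let $v_q(S)=c\sum_i \mathbb E_{u\sim q_i}[\min(s_i,u)]$ and $OPT_V(q)=\max\{v_q(S):\sum_i s_i=V\}$. Here $c>0$ is an arbitrary fixed unit in which utility is measured ($c=1$: number of shares; $c=1/(UV)$: normalized welfare). Write $q_t$ for the true posterior distributions of the usages $u_{it}$ given $(r_{it},H_t)$. The lender's utility is $v_{\mathcal A}=\sum_{t=1}^T\mathbb E[v_{q_t}(S_t)]$ and the lender's optimal utility is $OPT_V=\sum_{t=1}^T\mathbb E[OPT_V(q_t)]$.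 **PrivAuc** with parameters $V$, $\alpha,\epsilon>0$, $\rho,\beta\in(0,1)$, on valuations $v_1,\dots,v_n$. Let $\tau=\lceil 2V/(\alpha\rho n)\rceil$, $N=n\tau$, $\epsilon'=\epsilon\alpha\rho n/V$, $E=2\sqrt2\,\log(1/\beta)\log(N)^{5/2}/\epsilon'$, $V'=V-2E$. $C[t]$ is the output, after $t$ bits, of the binary counting mechanism with privacy parameter $\epsilon'$ and horizon $N$: $(0,t]$ is split into dyadic blocks according to the binary expansion of $t$, and the number of ones in each block is released with independent Laplace noise of scale $(\lfloor\log_2N\rfloor+1)/\epsilon'$. The auction has at most $\tau$ rounds. A round is started only if the noisy number of bids in the preceding round, $C[t]-C[t-n]$ ($n$ before the first round), exceeds $\rho n-2E$; in it the clients have one turn each, in order. At a turn, at time $t$, client $i$ first loses those of her shares for which the noisy number of bids placed since their acquisition is at least $V'$; then, holding $s$ shares, she bids (and gets one share) if $v_i(s+1)-v_i(s)\ge\alpha\lfloor C[t]/V'\rfloor$; the bit saying whether she bid is fed to the counter. The output is the number of shares held by each client at the end. The **Private Greedy Mechanism** runs PrivAuc in each round with fresh noise on the estimated posteriors $\mathbf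 1_{r_{it}}$ (the point masses at the requests), that is on the valuations $v_i(s)=\frac1U\min(s,r_{it})$. **Theorem.** Let the parameters be such that PrivAuc has the one-round accuracy guarantee $\mathbb E[v_q(S)]\ge(1-\rho)OPT_V(q)-\rho$ for every profile $q=(\mathbf 1_{r_1},\dots,\mathbf 1_{r_n})$ of point masses, where $S$ is the output of PrivAuc on this profile. If all clients use the truthful strategy in every round, then for all usage distributions $U_1,\dots,U_n$ and every $T$ the Private Greedy Mechanism satisfies $$v_{\mathcal A}\;\ge\;(1-\rho)\,OPT_V-\rho\,T .$$ -/

import Mathlib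

open MeasureTheory Finset
open scoped ENNReal NNReal

namespace SecLend

noncomputable section

/-! ## Standard Laplace noise -/

/-- The standard Laplace distribution, with density `x ↦ exp (-|x|) / 2` on the real line. -/
def stdLaplace : Measure ℝ :=
  (volume : Measure ℝ).withDensity fun x => ENNReal.ofReal (Real.exp (-|x|) / 2)

instance : IsProbabilityMeasure stdLaplace := by
  have h1 : ∫ x : ℝ, Real.exp (-|x|) / 2 = 1 := by
    have h := integral_comp_abs (f := fun x : ℝ => Real.exp (-x) / 2)
    rw [h, integral_div, integral_exp_neg_Ioi_zero]
    norm_num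
  have h2 : Integrable fun x : ℝ => Real.exp (-|x|) / 2 := by
    by_contra hc
    rw [integral_undef hc] at h1
    exact zero_ne_one h1
  constructor
  rw [stdLaplace, withDensity_apply _ MeasurableSet.univ, Measure.restrict_univ,
    ← ofReal_integral_eq_lintegral_ofReal h2 (Filter.Eventually.of_forall fun x => by positivity),
    h1, ENNReal.ofReal_one]

/-- A realization of the noise of the binary counting mechanism: the number `ω (j, k)` belongs to
the dyadic block of times `((k - 1) * 2 ^ j, k * 2 ^ j]`. -/
abbrev Noise : Type := ℕ × ℕ → ℝ

/-- Independent standard Laplace variables, one for each dyadic block. -/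
def noiseLaw : Measure Noise := Measure.infinitePi fun _ => stdLaplace

instance : IsProbabilityMeasure noiseLaw := by
  unfold noiseLaw; infer_instance

/-! ## The binary counting mechanism -/

/-- Number of dyadic levels for the time horizon `N`; every time in `{1, …, N}` lies in exactly one
block of each level. -/
def levels (N : ℕ) : ℕ := Nat.log 2 N + 1

/-- The output after `t` time steps of the binary mechanism with privacy parameter `ε` and time
horizon `N`, on the bit stream whose bit at time `τ ≥ 1` is `1` exactly if `τ ∈ bits`: `(0, t]` is
split into dyadic blocks according to the binary expansion of `t`, and the number of ones in each
of these blocks is released with Laplace noise of scale `levels N / ε`. -/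
def counter (ε : ℝ) (N : ℕ) (ω : Noise) (bits : Finset ℕ) (t : ℕ) : ℝ :=
  ∑ j ∈ range (levels N), if t.testBit j then
    (((bits ∩ Finset.Ioc ((t / 2 ^ j - 1) * 2 ^ j) (t / 2 ^ j * 2 ^ j)).card : ℝ)
      + levels N / ε * ω (j, t / 2 ^ j)) else 0

/-! ## The private ascending auction -/

/-- The parameters of the private auction with `n` bidders: the supply `V`, the price increment
`α`, the failure probability `β`, the privacy parameter `ε`, and the accuracy parameter `ρ`. -/
structure AuctionParams (n : ℕ) where
  V : ℕ
  α : ℝ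
  β : ℝ
  ε : ℝ
  ρ : ℝ

namespace AuctionParams

variable {n : ℕ} (P : AuctionParams n)

/-- The maximal number of rounds of bidding, `2 V / (α ρ n)` rounded up. -/
def rounds : ℕ := ⌈2 * P.V / (P.α * P.ρ * n)⌉₊

/-- The time horizon of the bid counter: one bit per bidder and round. -/
def horizon : ℕ := n * P.rounds

/-- The privacy parameter of the bid counter. -/
def ε' : ℝ := P.ε * (P.α * P.ρ * n) / P.V

/-- The error bound of the bid counter. -/
def E : ℝ := 2 * √2 * Real.log (1 / P.β) * Real.log P.horizon ^ (5 / 2 : ℝ) / P.ε'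

/-- The reduced supply. -/
def V' : ℝ := P.V - 2 * P.E

end AuctionParams

/-- The state of the auction: the number `time` of bits fed to the counter so far, the set `bids`
of those times at which the bit was `1`, and for each bidder the shares she holds. A bidder acquires
at most one share in each time step, so that a share is identified by its acquisition time. -/
structure AuctionState (n : ℕ) where
  time : ℕ
  bids : Finset ℕ
  held : Fin n → Finset ℕ

section Auction

variable {n : ℕ} (P : AuctionParams n) (v : Fin n → ℕ → ℝ) (ω : Noise)

/-- The noisy bid count after `t` time steps. -/
def AuctionState.count (st : AuctionState n) (t : ℕ) : ℝ :=
  counter P.ε' P.horizon ω st.bids t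

/-- The current price. -/
def AuctionState.price (st : AuctionState n) : ℝ :=
  P.α * ⌊st.count P ω st.time / P.V'⌋

/-- The shares that bidder `i` keeps at her turn: the noisy number of bids that were placed since
the share was acquired (the sum, over her turns since then, of the noisy numbers of bids since
her preceding turn) is below `V'`. -/
def AuctionState.kept (st : AuctionState n) (i : Fin n) : Finset ℕ :=
  open Classical in
  (st.held i).filter fun a => st.count P ω st.time - st.count P ω a < P.V'

/-- The turn of bidder `i`. She loses the shares that are used up, and then bids for one more share
if its marginal value is at least the price; her bit is fed to the counter. -/
def turn (st : AuctionState n) (i : Fin n) : AuctionState n :=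
  open Classical in
  let K := st.kept P ω i
  if st.price P ω ≤ v i (K.card + 1) - v i K.card then
    { time := st.time + 1
      bids := insert (st.time + 1) st.bids
      held := Function.update st.held i (insert st.time K) }
  else
    { time := st.time + 1
      bids := st.bids
      held := Function.update st.held i K }

/-- The noisy number of bids in the last round (`n` before the first round). -/
def AuctionState.roundBids (st : AuctionState n) : ℝ :=
  if st.time = 0 then n else st.count P ω st.time - st.count P ω (st.time - n)

/-- One iteration of the main loop: if enough bids were counted in the last round, every bidder has
one turn, in the order `0, …, n - 1`; otherwise the auction has ended. -/
def auctionRound (st : AuctionState n) : AuctionState n :=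
  open Classical in
  if P.ρ * n - 2 * P.E < st.roundBids P ω then
    (List.finRange n).foldl (turn P v ω) st
  else st

/-- The final state of the auction. -/
def runAuction : AuctionState n :=
  (auctionRound P v ω)^[P.rounds] { time := 0, bids := ∅, held := fun _ => ∅ }

/-- The number of shares of each bidder at the end of the auction, for given noise. -/
def auctionAlloc : Fin n → ℕ := fun i => ((runAuction P v ω).held i).card

end Auction

/-! ### Measurability of the auction in the noise -/

/-- All level sets of `f` are measurable. -/
def LevelMeas {β : Type*} (f : Noise → β) : Prop := ∀ y, MeasurableSet {ω | f ω = y}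

lemma LevelMeas.const {β : Type*} (b : β) : LevelMeas fun _ => b := fun _ => .const _

lemma LevelMeas.bind {β γ : Type*} [Countable β] {f : Noise → β} {g : Noise → β → γ}
    (hf : LevelMeas f) (hg : ∀ b, LevelMeas fun ω => g ω b) : LevelMeas fun ω => g ω (f ω) := by
  intro y
  have : {ω | g ω (f ω) = y} = ⋃ b, {ω | f ω = b} ∩ {ω | g ω b = y} := by
    ext ω; simp
  rw [this]
  exact MeasurableSet.iUnion fun b => (hf b).inter (hg b y)

lemma LevelMeas.ite {β : Type*} {p : Noise → Prop} [∀ ω, Decidable (p ω)] {f g : Noise → β}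
    (hp : MeasurableSet {ω | p ω}) (hf : LevelMeas f) (hg : LevelMeas g) :
    LevelMeas fun ω => if p ω then f ω else g ω := by
  intro y
  have : {ω | (if p ω then f ω else g ω) = y} =
      ({ω | p ω} ∩ {ω | f ω = y}) ∪ ({ω | p ω}ᶜ ∩ {ω | g ω = y}) := by
    ext ω
    by_cases h : p ω <;> simp [h]
  rw [this]
  exact (hp.inter (hf y)).union (hp.compl.inter (hg y))

lemma LevelMeas.filter {p : Noise → ℕ → Prop} [∀ ω, DecidablePred (p ω)]
    (hp : ∀ a, MeasurableSet {ω | p ω a}) (s : Finset ℕ) :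
    LevelMeas fun ω => s.filter (p ω) := by
  induction s using Finset.induction_on with
  | empty => simpa using LevelMeas.const (∅ : Finset ℕ)
  | insert a s _ ih =>
    simp only [Finset.filter_insert]
    exact LevelMeas.ite (hp a)
      (LevelMeas.bind (g := fun _ t => insert a t) ih fun _ => LevelMeas.const _) ih

instance {n : ℕ} : Countable (AuctionState n) := by
  have : Function.Injective fun st : AuctionState n => (st.time, st.bids, st.held) := by
    rintro ⟨a, b, c⟩ ⟨a', b', c'⟩ h
    simpa using h
  exact this.countable

section Measurability

variable {n : ℕ} (P : AuctionParams n) (v : Fin n → ℕ → ℝ)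

lemma measurable_count (st : AuctionState n) (t : ℕ) :
    Measurable fun ω => st.count P ω t := by
  unfold AuctionState.count counter
  refine Finset.measurable_sum _ fun j _ => ?_
  split_ifs
  · fun_prop
  · fun_prop

lemma levelMeas_turn (st : AuctionState n) (i : Fin n) :
    LevelMeas fun ω => turn P v ω st i := by
  classical
  unfold turn
  have hK : LevelMeas fun ω => st.kept P ω i :=
    LevelMeas.filter (fun a => measurableSet_lt
      ((measurable_count P st _).sub (measurable_count P st a)) measurable_const) _
  have hp : Measurable fun ω => st.price P ω := by
    unfold AuctionState.price
    have h1 : Measurable fun ω => ⌊st.count P ω st.time / P.V'⌋ :=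
      ((measurable_count P st _).div_const _).floor
    exact (measurable_from_top (f := fun z : ℤ => P.α * (z : ℝ))).comp h1
  exact LevelMeas.bind
    (g := fun ω K => if st.price P ω ≤ v i (K.card + 1) - v i K.card then
        AuctionState.mk (st.time + 1) (insert (st.time + 1) st.bids)
          (Function.update st.held i (insert st.time K))
      else AuctionState.mk (st.time + 1) st.bids (Function.update st.held i K))
    hK fun K => LevelMeas.ite (measurableSet_le hp measurable_const)
      (LevelMeas.const _) (LevelMeas.const _)

lemma levelMeas_auctionRound (st : AuctionState n) :
    LevelMeas fun ω => auctionRound P v ω st := by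
  classical
  unfold auctionRound
  refine LevelMeas.ite (measurableSet_lt measurable_const ?_) ?_ (LevelMeas.const _)
  · unfold AuctionState.roundBids
    split_ifs
    · fun_prop
    · exact (measurable_count P st _).sub (measurable_count P st _)
  · generalize List.finRange n = l
    induction l generalizing st with
    | nil => exact LevelMeas.const _
    | cons i l ih =>
      exact LevelMeas.bind (g := fun ω s => l.foldl (turn P v ω) s) (levelMeas_turn P v st i) ih

lemma levelMeas_runAuction : LevelMeas fun ω => runAuction P v ω := by
  unfold runAuction
  generalize P.rounds = k
  induction k with
  | zero => exact LevelMeas.const _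
  | succ k ih =>
    simp only [Function.iterate_succ_apply']
    exact LevelMeas.bind ih fun st => levelMeas_auctionRound P v st

lemma measurable_auctionAlloc : Measurable fun ω => auctionAlloc P v ω :=
  measurable_to_countable' fun y => LevelMeas.bind
    (g := fun _ (st : AuctionState n) (i : Fin n) => (st.held i).card)
    (levelMeas_runAuction P v) (fun _ => LevelMeas.const _) y

instance : IsProbabilityMeasure (noiseLaw.map fun ω => auctionAlloc P v ω) :=
  Measure.isProbabilityMeasure_map (measurable_auctionAlloc P v).aemeasurable

/-- The private auction, as a randomized map from the bidders' valuation functions to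
allocations. -/
def privAuc : PMF (Fin n → ℕ) := (noiseLaw.map fun ω => auctionAlloc P v ω).toPMF

end Measurability

/-! ## Allocations, values, and the optimal value

Usages and requests range over `{0, …, U}`. A (posterior) distribution of a client's usage is
represented by its mass function `Fin (U + 1) → ℝ`. -/

section Values

variable {n U : ℕ}

/-- The expectation of a real function. -/
def pmfExpect {X : Type*} (p : PMF X) (f : X → ℝ) : ℝ := ∑' x, (p x).toReal * f x

/-- The expected number of executed shares, `E[min (s, u)]` for `u ∼ q`. -/
def executed (q : Fin (U + 1) → ℝ) (s : ℕ) : ℝ := ∑ u, q u * (min s (u : ℕ) : ℕ)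

/-- The valuation function in the auction of a client with posterior `q`. -/
def valuation (q : Fin (U + 1) → ℝ) (s : ℕ) : ℝ := 1 / U * executed q s

/-- The lender's expected number of executed shares for the allocation `S`, given the posteriors. -/
def lenderValue (q : Fin n → Fin (U + 1) → ℝ) (S : Fin n → ℕ) : ℝ := ∑ i, executed (q i) (S i)

/-- The lender's optimal expected number of executed shares when `V` shares are allocated. -/
def optValue (V : ℕ) (q : Fin n → Fin (U + 1) → ℝ) : ℝ :=
  ⨆ S : {S : Fin n → ℕ // ∑ i, S i = V}, lenderValue q S

/-- The mass function of the point mass at `r`. -/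
def pointMass (r : Fin (U + 1)) : Fin (U + 1) → ℝ := Pi.single r 1

end Values

/-! ## Allocation mechanisms over several rounds -/

section Mechanisms

variable {n U : ℕ}

/-- What is observed in one round: the requests, the allocation, and the executed shares. -/
structure RoundRecord (n U : ℕ) where
  request : Fin n → Fin (U + 1)
  alloc : Fin n → ℕ
  exec : Fin n → ℕ

/-- The observations of all earlier rounds, the oldest round first. -/
abbrev History (n U : ℕ) : Type := List (RoundRecord n U)

/-- The observations of a single client: her requests, allocations, and executed shares. -/
abbrev ClientHistory (U : ℕ) : Type := List (Fin (U + 1) × ℕ × ℕ)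

/-- The part of the history that concerns client `i`. -/
def History.client (H : History n U) (i : Fin n) : ClientHistory U :=
  H.map fun R => (R.request i, R.alloc i, R.exec i)

/-- A strategy of a client: a randomized map from her history and her usage to a request. (The
number of the round is one more than the length of the history.) -/
abbrev Strategy (U : ℕ) : Type := ClientHistory U → Fin (U + 1) → PMF (Fin (U + 1))

/-- The truthful strategy. -/
def truthful : Strategy U := fun _ u => PMF.pure u

/-- An allocation mechanism: a randomized map from the requests and the history to allocations. -/
abbrev Mechanism (n U : ℕ) : Type :=
  (Fin n → Fin (U + 1)) → History n U → PMF (Fin n → ℕ)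

/-- The private greedy mechanism: the posterior of each client is estimated by the point mass at
her request, and the private auction is run, with fresh noise, on these estimates. -/
def privateGreedy (P : AuctionParams n) : Mechanism n U :=
  fun r _ => privAuc P fun i => valuation (pointMass (r i))

/-- Independent draws from finitely many distributions on a finite type. -/
def indep {X : Type*} [Fintype X] (p : Fin n → PMF X) : PMF (Fin n → X) :=
  PMF.ofFintype (fun x => ∏ i, p i (x i)) (by
    classical
    have h := Finset.prod_univ_sum (fun _ : Fin n => (Finset.univ : Finset X))
      (fun i x => p i x)
    rw [Fintype.piFinset_univ] at h
    rw [← h]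
    refine Finset.prod_eq_one fun i _ => ?_
    rw [← tsum_fintype (L := SummationFilter.unconditional _)]
    exact (p i).tsum_coe)

variable (D : Fin n → PMF (Fin (U + 1))) (L : Fin n → Strategy U) (A : Mechanism n U)

/-- The joint law of the clients' usages and requests in the round after the history `H`: each
client `i` independently draws a usage from `D i` and a request from her strategy. -/
def drawRound (H : History n U) : PMF (Fin n → Fin (U + 1) × Fin (U + 1)) :=
  indep fun i => (D i).bind fun u => (L i (H.client i) u).map fun r => (u, r)

/-- The law of the history of the first `t` rounds. -/
def historyLaw : ℕ → PMF (History n U)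
  | 0 => PMF.pure []
  | t + 1 =>
    (historyLaw t).bind fun H =>
      (drawRound D L H).bind fun x =>
        (A (fun i => (x i).2) H).map fun S =>
          H ++ [{ request := fun i => (x i).2
                  alloc := S
                  exec := fun i => min (S i) ((x i).1 : ℕ) }]

/-- The joint law of the history of the first `t` rounds and the requests of the next round. -/
def requestLaw (t : ℕ) : PMF (History n U × (Fin n → Fin (U + 1))) :=
  (historyLaw D L A t).bind fun H =>
    (drawRound D L H).map fun x => (H, fun i => (x i).2)

/-- The posterior probability, by Bayes' rule, that the usage of client `i` in the round after the
history `H` is `u`, given that her request in this round is `r`. -/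
def posterior (H : History n U) (i : Fin n) (r u : Fin (U + 1)) : ℝ :=
  (D i u * L i (H.client i) u r).toReal /
    ∑ u', (D i u' * L i (H.client i) u' r).toReal

/-- The lender's utility over `T` rounds: the expected total number of executed shares, where the
usages in each round are drawn from their posteriors given the requests and the history. -/
def lenderUtility (T : ℕ) : ℝ :=
  ∑ t ∈ range T, pmfExpect (requestLaw D L A t) fun x =>
    pmfExpect (A x.2 x.1) fun S => lenderValue (fun i => posterior D L x.1 i (x.2 i)) S

/-- The lender's optimal utility over `T` rounds: in every round, `V` shares are allocated
optimally with respect to the true posteriors. -/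
def optUtility (V T : ℕ) : ℝ :=
  ∑ t ∈ range T, pmfExpect (requestLaw D L A t) fun x =>
    optValue V fun i => posterior D L x.1 i (x.2 i)

end Mechanisms

end

end SecLend

namespace SecLend

/-! ### Expectations of bounded functions under a `PMF` -/

section Expectation

variable {X : Type*}

/-! Under truthful play a request of positive probability equals the usage, so Bayes' rule returns
the point mass at the request (`posterior_truthful`, `posterior_eq_pointMass`). The estimated
posteriors of the private greedy mechanism are therefore almost surely the true ones. The mechanism
ignores the history, so in each round both the optimum and the achieved value depend on the request
vector alone, and `hacc` compares them pointwise. Integrating this affine inequality over the law of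
history and requests (`pmfExpect_affine_le`) and summing over the rounds gives the claim; each round
contributes one additive loss `P.ρ`. -/

/-- Dominated by `B` times the mass function. This is needed because `pmfExpect` is a `tsum`, which
defaults to `0` when the series diverges. -/
lemma summable_pmf_mul (p : PMF X) {f : X → ℝ} {B : ℝ} (hf : ∀ x, |f x| ≤ B) :
    Summable fun x => (p x).toReal * f x := by
  have h : Summable fun x => (p x).toReal * B :=
    (ENNReal.summable_toReal p.tsum_coe_ne_top).mul_right B
  refine Summable.of_norm_bounded h fun x => ?_
  rw [norm_mul, Real.norm_eq_abs, Real.norm_eq_abs, abs_of_nonneg ENNReal.toReal_nonneg]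
  exact mul_le_mul_of_nonneg_left (hf x) ENNReal.toReal_nonneg

lemma tsum_toReal_pmf (p : PMF X) : ∑' x, (p x).toReal = 1 := by
  rw [← ENNReal.tsum_toReal_eq fun x => p.apply_ne_top x, p.tsum_coe, ENNReal.toReal_one]

/-- Agreement on the support is all that is available later: the posterior is a point mass only at
requests of positive probability. -/
lemma pmfExpect_congr (p : PMF X) {f g : X → ℝ} (h : ∀ x ∈ p.support, f x = g x) :
    pmfExpect p f = pmfExpect p g := by
  refine tsum_congr fun x => ?_
  by_cases hx : p x = 0
  · simp [hx]
  · rw [h x ((p.mem_support_iff x).2 hx)]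

/-- An affine inequality between bounded functions carries over to their expectations. -/
lemma pmfExpect_affine_le (p : PMF X) {f g : X → ℝ} {A B : ℝ} (hf : ∀ x, |f x| ≤ A)
    (hg : ∀ x, |g x| ≤ B) (a b d : ℝ) (h : ∀ x, a * f x - d ≤ b * g x) :
    a * pmfExpect p f - d ≤ b * pmfExpect p g := by
  have sf := (summable_pmf_mul p hf).mul_left a
  have sg := (summable_pmf_mul p hg).mul_left b
  have sd := (ENNReal.summable_toReal p.tsum_coe_ne_top).mul_right d
  -- Total mass one turns the constant `d` into an expectation, so that the series can be compared
  -- term by term.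
  have hd : ∑' x, (p x).toReal * d = d := by rw [tsum_mul_right, tsum_toReal_pmf, one_mul]
  unfold pmfExpect
  rw [← tsum_mul_left, ← tsum_mul_left]
  rw [← hd, ← sf.tsum_sub sd]
  refine (sf.sub sd).tsum_le_tsum (fun x => ?_) sg
  have := mul_le_mul_of_nonneg_left (h x) (ENNReal.toReal_nonneg (a := p x))
  linarith

end Expectation

/-! ### Posteriors under truthful requests -/

section Truthful

variable {n U : ℕ} (D : Fin n → PMF (Fin (U + 1)))

/-- A truthful request that has positive probability reveals the usage. -/
lemma posterior_truthful (H : History n U) (i : Fin n) {r : Fin (U + 1)} (hr : D i r ≠ 0) :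
    posterior D (fun _ => truthful) H i r = pointMass r := by
  -- Without this the quotient in Bayes' rule would be `0 / 0 = 0` at `u = r`, not `1`.
  have h0 : (D i r).toReal ≠ 0 := (ENNReal.toReal_pos hr ((D i).apply_ne_top r)).ne'
  have hsum : ∑ u', (D i u' * truthful (H.client i) u' r).toReal = (D i r).toReal := by
    -- Only the usage `r` itself can produce the request `r`, so the normalizing sum has a single
    -- nonzero term.
    rw [Finset.sum_eq_single r] <;> simp +contextual [truthful, PMF.pure_apply, eq_comm]
  funext u
  unfold posterior
  rw [hsum]
  by_cases hu : u = r
  · subst hu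
    simp [truthful, pointMass, h0]
  · simp [truthful, PMF.pure_apply, pointMass, hu, Ne.symm hu]

/-- Truthful requests lie in the supports of the usage distributions. -/
lemma ne_zero_of_mem_support_requestLaw (A : Mechanism n U) (t : ℕ)
    {x : History n U × (Fin n → Fin (U + 1))}
    (hx : x ∈ (requestLaw D (fun _ => truthful) A t).support) (i : Fin n) :
    D i (x.2 i) ≠ 0 := by
  unfold requestLaw at hx
  rw [PMF.mem_support_bind_iff] at hx
  obtain ⟨H, -, hx⟩ := hx
  rw [PMF.mem_support_map_iff] at hx
  obtain ⟨y, hy, rfl⟩ := hx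
  rw [PMF.mem_support_iff, drawRound, indep, PMF.ofFintype_apply] at hy
  -- The joint mass is a product over clients, so each factor is nonzero; a truthful draw then has
  -- the form `(u, u)` with `u` in the support of `D i`.
  have hyi := Finset.prod_ne_zero_iff.1 hy i (Finset.mem_univ i)
  rw [← PMF.mem_support_iff, PMF.mem_support_bind_iff] at hyi
  obtain ⟨u, hu, hyi⟩ := hyi
  simp only [truthful, PMF.pure_map, PMF.support_pure, Set.mem_singleton_iff] at hyi
  change D i (y i).2 ≠ 0
  rw [hyi]
  exact (PMF.mem_support_iff _ _).1 hu

lemma posterior_eq_pointMass (A : Mechanism n U) (t : ℕ)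
    {x : History n U × (Fin n → Fin (U + 1))}
    (hx : x ∈ (requestLaw D (fun _ => truthful) A t).support) :
    (fun i => posterior D (fun _ => truthful) x.1 i (x.2 i)) = fun i => pointMass (x.2 i) :=
  funext fun i => posterior_truthful D x.1 i (ne_zero_of_mem_support_requestLaw D A t hx i)

end Truthful

end SecLend

/-! ### The utility guarantee -/

open SecLend in
theorem theorem7 {n U : ℕ} (hn : 0 < n) (hU : 0 < U) (P : AuctionParams n) (hV : 0 < P.V)
    (hα : 0 < P.α) (hε : 0 < P.ε) (hβ : P.β ∈ Set.Ioo (0 : ℝ) 1) (hρ : P.ρ ∈ Set.Ioo (0 : ℝ) 1)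
    (c : ℝ) (hc : 0 < c)
    (hacc : ∀ r : Fin n → Fin (U + 1),
      (1 - P.ρ) * (c * optValue P.V fun i => pointMass (r i)) - P.ρ ≤
        c * pmfExpect (privAuc P fun i => valuation (pointMass (r i)))
          (lenderValue fun i => pointMass (r i)))
    (D : Fin n → PMF (Fin (U + 1))) (T : ℕ) :
    (1 - P.ρ) * (c * optUtility D (fun _ => truthful) (privateGreedy P) P.V T) - P.ρ * T ≤
      c * lenderUtility D (fun _ => truthful) (privateGreedy P) T := by
  have round (t : ℕ) :
      (1 - P.ρ) * c * (pmfExpect (requestLaw D (fun _ => truthful) (privateGreedy P) t) fun x =>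
        optValue P.V fun i => posterior D (fun _ => truthful) x.1 i (x.2 i)) - P.ρ ≤
      c * pmfExpect (requestLaw D (fun _ => truthful) (privateGreedy P) t) fun x =>
        pmfExpect (privateGreedy P x.2 x.1) fun S =>
          lenderValue (fun i => posterior D (fun _ => truthful) x.1 i (x.2 i)) S := by
    let F : (Fin n → Fin (U + 1)) → ℝ := fun r => optValue P.V fun i => pointMass (r i)
    let G : (Fin n → Fin (U + 1)) → ℝ := fun r =>
      pmfExpect (privAuc P fun i => valuation (pointMass (r i)))
        (lenderValue fun i => pointMass (r i))
    have hopt := pmfExpect_congr (requestLaw D (fun _ => truthful) (privateGreedy P) t)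
      (f := fun x => optValue P.V fun i => posterior D (fun _ => truthful) x.1 i (x.2 i))
      (g := fun x => F x.2) fun x hx => by
        simp only [posterior_eq_pointMass D _ t hx, F]
    have hval := pmfExpect_congr (requestLaw D (fun _ => truthful) (privateGreedy P) t)
      (f := fun x => pmfExpect (privateGreedy P x.2 x.1) fun S =>
          lenderValue (fun i => posterior D (fun _ => truthful) x.1 i (x.2 i)) S)
      (g := fun x => G x.2) fun x hx => by
        simp only [posterior_eq_pointMass D _ t hx, G, privateGreedy]
    have hFG (r) : (1 - P.ρ) * c * F r - P.ρ ≤ c * G r := by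
      rw [mul_assoc]
      exact hacc r
    rw [hopt, hval]
    clear_value F G
    -- Histories range over an infinite type, but `F` and `G` see only the request vector, of which
    -- there are finitely many. Boundedness is thus automatic, with no estimate of the supremum or
    -- of the inner expectation.
    obtain ⟨A, hA⟩ := Finite.exists_le fun r => |F r|
    obtain ⟨B, hB⟩ := Finite.exists_le fun r => |G r|
    exact pmfExpect_affine_le (requestLaw D (fun _ => truthful) (privateGreedy P) t)
      (f := fun x => F x.2) (g := fun x => G x.2) (fun x => hA x.2) (fun x => hB x.2) _ _ _ fun x => hFG x.2
  have total := Finset.sum_le_sum fun t (_ : t ∈ Finset.range T) => round t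
  rw [Finset.sum_sub_distrib, ← Finset.mul_sum, ← Finset.mul_sum, Finset.sum_const,
    Finset.card_range, nsmul_eq_mul] at total
  unfold optUtility lenderUtility
  rw [← mul_assoc, mul_comm P.ρ]
  exact total
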